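/- Let $(W_s)_{s\ge 0}$ be a standard Brownian motion with $W_0=0$ on a probability space with measure $P$. Let $b:(0,\infty)\to\mathbb{R}$ be a continuous function for which the limit $b(0):=\lim_{s\downarrow 0}b(s)$ exists in $[-\infty,\infty)$ and satisfies $b(0)\le 0$; if $b(0)=-\infty$, assume moreover that $b$ is monotone increasing on $(0,\varepsilon]$ for some $\varepsilon>0$. Let $$\tau=\inf\{s>0:\ W_s\le b(s)\}\in[0,\infty]$$ (with $\inf\emptyset=\infty$) be the first passage time of $W$ to $b$, assume that $b$ is regular in the sense that $P(\tau=0)=0$, and let $F(s)=P(\tau\le s)$ be the distribution function of $\tau$, with associated measure $F(ds)$ on $[0,\infty)$. For $p\in\mathbb{R}$ let $D_p$ denote the parabolic cylinder function, that is $$D_p(z)=\frac{e^{-z^2/4}}{\Gamma(-p)}\int_0^\infty e^{-xz-x^2/2}x^{-p-1}\,dx\quad(p<0),$$ $$D_p(z)=(-1)^n e^{z^2/4}\frac{d^n}{dz^n}\left(e^{-z^2/4}D_{p-n}(z)\right)\quad(p\ge 0,\ n=\lfloor p\rfloor+1).$$ Then for every $p\in\mathbb{R}$, every $t>0$ and every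 $y<b(t)$, the integrand on the right-hand side below is $F$-integrable on $(0,t)$ and $$\frac{e^{-\frac{y^2}{4t}}D_p(-y/\sqrt t)}{t^{(p+1)/2}}=\int_{(0,t)}e^{-\frac{(b(s)-y)^2}{4(t-s)}}\,\frac{D_p\big((b(s)-y)/\sqrt{t-s}\big)}{(t-s)^{(p+1)/2}}\,F(ds).$$ -/

import Mathlib

open MeasureTheory ProbabilityTheory Set Filter Topology
open scoped ENNReal NNReal

/-- The parabolic cylinder function `D_q(z)` of negative order `q < 0`, given by its classical
integral representation. -/
noncomputable def parabolicCylinderNeg (q z : ℝ) : ℝ :=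
  Real.exp (-z ^ 2 / 4) / Real.Gamma (-q) *
    ∫ x in Ioi (0 : ℝ), Real.exp (-x * z - x ^ 2 / 2) * x ^ (-q - 1)

/-- The parabolic cylinder function `D_p(z)` for all real orders `p`. For `p < 0` it is the integral
representation; for `p ≥ 0` it is obtained from the order `p - n ∈ [-1, 0)`, `n = ⌊p⌋ + 1`, by the
classical raising formula `(d/dz)^n (e^{-z²/4} D_{p-n}(z)) = (-1)^n e^{-z²/4} D_p(z)`. -/
noncomputable def parabolicCylinder (p z : ℝ) : ℝ :=
  if p < 0 then parabolicCylinderNeg p z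
  else (-1) ^ (⌊p⌋₊ + 1) * Real.exp (z ^ 2 / 4) *
    iteratedDeriv (⌊p⌋₊ + 1)
      (fun w : ℝ => Real.exp (-w ^ 2 / 4) * parabolicCylinderNeg (p - (⌊p⌋₊ + 1)) w) z

/-- The first passage time `τ = inf {s > 0 : W_s ≤ b(s)}`, with values in `[0, ∞]`
(it is `∞` if there is no such `s`). -/
noncomputable def firstPassageTime {Ω : Type*} (W : ℝ≥0 → Ω → ℝ) (b : ℝ → ℝ) (ω : Ω) : ℝ≥0∞ :=
  sInf ((fun s : ℝ≥0 => (s : ℝ≥0∞)) '' {s : ℝ≥0 | 0 < s ∧ W s ω ≤ b (s : ℝ)})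

/-- The distribution `F(ds) = P(τ ∈ ds)` of the first passage time on the real line. It is the law of
`τ` restricted to finite values, so its mass is `P(τ < ∞)`, and `F((-∞, s]) = P(τ ≤ s)` for real
`s ≥ 0`. -/
noncomputable def firstPassageDistribution {Ω : Type*} [MeasurableSpace Ω]
    (W : ℝ≥0 → Ω → ℝ) (b : ℝ → ℝ) (P : Measure Ω) : Measure ℝ :=
  ((P.map (firstPassageTime W b)).restrict {∞}ᶜ).map ENNReal.toReal

/-!
The proof has a probabilistic half, which gives the equation for `p < 0`, and an analytic half,
which raises the order.

*Order `p < 0`.* A path that ends at time `t` below `y < b t` has crossed the boundary before `t`,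
and at the first passage time `τ` it sits on the boundary, by continuity. The Markov property at
`τ` (`setLIntegral_firstPassageTime_lt`) then says that, on the half-line below `b t`, the law of
`W t` is the mixture of the Gaussian laws `N(b s, t - s)` over `s` with weight `F(ds)`. Integrating
the function `x ↦ (y - x)₊^a`, `a = -p - 1 > -1`, against both sides gives the integral equation,
because `E (y - N)₊^a` for a Gaussian variable `N` is, up to constants, a parabolic cylinder
function of order `p` (`lintegral_gaussianReal_indicator_rpow`). All terms are nonnegative and the
left side is finite, so integrability comes for free, however fast `b` tends to `-∞` at `0`.

*Order `p ≥ 0`.* Write `p = n - a - 1` with `n = ⌊p⌋ + 1` and `-1 < a ≤ 0`. Then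
`Γ(a + 1) e^{-z²/4} D_p(z) = ∫₀^∞ He_n(x + z) e^{-(x + z)²/2} x^a dx`, and the scaled kernels
`hermiteKernel a n` satisfy `∂/∂y K_n(r, x - y) = K_{n + 1}(r, x - y)`. The equation of order `p` is
the `n`-th derivative in `y` of the one of order `-a - 1`. Differentiation under the integral is
justified by `exists_abs_hermiteKernel_le`: the kernels are bounded for `a ≤ 0`.

The Markov property at `τ` is obtained by approximating `τ` from the right by times in a finite grid
and using independence of increments on each event `{s_k ≤ τ < s_{k+1}}`, which belongs to the past
of `s_{k+1}`.
-/

/-! ### Hermite functions -/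

/-- The Hermite function `He_n(u) e^{-u²/2}`, with the probabilists' Hermite polynomial `He_n`;
it is `(-1)^n` times the `n`-th derivative of `e^{-u²/2}`. -/
noncomputable def hermiteGaussian (n : ℕ) (u : ℝ) : ℝ :=
  Polynomial.aeval u (Polynomial.hermite n) * Real.exp (-u ^ 2 / 2)

lemma hermiteGaussian_zero (u : ℝ) : hermiteGaussian 0 u = Real.exp (-u ^ 2 / 2) := by
  simp [hermiteGaussian]

lemma hasDerivAt_hermiteGaussian (n : ℕ) (u : ℝ) :
    HasDerivAt (hermiteGaussian n) (-hermiteGaussian (n + 1) u) u := by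
  have h1 : HasDerivAt (fun u : ℝ => Real.exp (-u ^ 2 / 2)) (Real.exp (-u ^ 2 / 2) * -u) u := by
    have : HasDerivAt (fun u : ℝ => -u ^ 2 / 2) (-u) u := by
      refine ((hasDerivAt_pow 2 u).neg.div_const 2).congr_deriv ?_
      norm_num
      ring
    exact this.exp
  have h2 := (Polynomial.hermite n).hasDerivAt_aeval u
  have h := h2.mul h1
  refine h.congr_deriv ?_
  simp only [hermiteGaussian, Polynomial.hermite_succ, map_sub, map_mul, Polynomial.aeval_X]
  ring

lemma continuous_hermiteGaussian (n : ℕ) : Continuous (hermiteGaussian n) :=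
  continuous_iff_continuousAt.2 fun u => (hasDerivAt_hermiteGaussian n u).continuousAt

lemma exists_abs_aeval_le_mul_exp (Q : Polynomial ℤ) :
    ∃ C : ℝ, 0 ≤ C ∧ ∀ u : ℝ, |Polynomial.aeval u Q| ≤ C * Real.exp (u ^ 2 / 4) := by
  induction Q using Polynomial.induction_on' with
  | add p q hp hq =>
    obtain ⟨C, hC, h⟩ := hp
    obtain ⟨D, hD, h'⟩ := hq
    refine ⟨C + D, by positivity, fun u => ?_⟩
    rw [map_add, add_mul]
    exact (abs_add_le _ _).trans (add_le_add (h u) (h' u))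
  | monomial n c =>
    refine ⟨|(c : ℝ)| * (n.factorial * Real.exp 1), by positivity, fun u => ?_⟩
    have h := Real.pow_div_factorial_le_exp |u| (abs_nonneg u) n
    rw [div_le_iff₀ (by positivity)] at h
    have h2 : Real.exp |u| ≤ Real.exp 1 * Real.exp (u ^ 2 / 4) := by
      rw [← Real.exp_add]
      refine Real.exp_le_exp.2 ?_
      nlinarith [sq_nonneg (|u| / 2 - 1), sq_abs u]
    simp only [Polynomial.aeval_monomial, algebraMap_int_eq, eq_intCast, abs_mul, abs_pow]
    rw [mul_assoc, mul_assoc]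
    gcongr
    calc |u| ^ n ≤ Real.exp |u| * n.factorial := h
      _ ≤ (Real.exp 1 * Real.exp (u ^ 2 / 4)) * n.factorial := by gcongr
      _ = _ := by ring

lemma exists_abs_hermiteGaussian_le (n : ℕ) :
    ∃ C : ℝ, 0 ≤ C ∧ ∀ u : ℝ, |hermiteGaussian n u| ≤ C * Real.exp (-u ^ 2 / 4) := by
  obtain ⟨C, hC, h⟩ := exists_abs_aeval_le_mul_exp (Polynomial.hermite n)
  refine ⟨C, hC, fun u => ?_⟩
  rw [hermiteGaussian, abs_mul, abs_of_pos (Real.exp_pos _)]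
  calc _ ≤ C * Real.exp (u ^ 2 / 4) * Real.exp (-u ^ 2 / 2) := by gcongr; exact h u
    _ = _ := by rw [mul_assoc, ← Real.exp_add]; ring_nf

/-! ### Mellin-type transforms of Hermite functions -/

/-- The integral `∫₀^∞ He_n(x + z) e^{-(x + z)²/2} x^a dx`. For `a > -1` it equals
`Γ(a + 1) e^{-z²/4} D_{n - a - 1}(z)`. -/
noncomputable def hermiteIntegral (a : ℝ) (n : ℕ) (z : ℝ) : ℝ :=
  ∫ x in Ioi (0 : ℝ), hermiteGaussian n (x + z) * x ^ a

lemma exp_neg_add_sq_le (x z R : ℝ) (hz : |z| ≤ R) :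
    Real.exp (-(x + z) ^ 2 / 4) ≤ Real.exp (R ^ 2 / 4) * Real.exp (-(1 / 8) * x ^ 2) := by
  rw [← Real.exp_add]
  refine Real.exp_le_exp.2 ?_
  have : z ^ 2 ≤ R ^ 2 := sq_le_sq' (abs_le.1 hz).1 (abs_le.1 hz).2
  nlinarith [sq_nonneg (x + 2 * z)]

lemma aestronglyMeasurable_hermiteGaussian_mul_rpow (a : ℝ) (n : ℕ) (z : ℝ) :
    AEStronglyMeasurable (fun x : ℝ => hermiteGaussian n (x + z) * x ^ a)
      (volume.restrict (Ioi 0)) := by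
  have := (continuous_hermiteGaussian n).measurable
  exact (Measurable.mul (this.comp (measurable_id.add_const z))
    (measurable_id.pow_const a)).aestronglyMeasurable

lemma integrableOn_const_mul_exp_mul_rpow {a : ℝ} (ha : -1 < a) {c : ℝ} (hc : 0 < c) (C : ℝ) :
    IntegrableOn (fun x : ℝ => C * Real.exp (-c * x ^ 2) * x ^ a) (Ioi 0) := by
  have := (integrableOn_rpow_mul_exp_neg_mul_sq hc ha).const_mul C
  refine this.congr (ae_of_all _ fun x => ?_)
  simp only
  ring

lemma integrableOn_hermiteGaussian_mul_rpow {a : ℝ} (ha : -1 < a) (n : ℕ) (z : ℝ) :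
    IntegrableOn (fun x : ℝ => hermiteGaussian n (x + z) * x ^ a) (Ioi 0) := by
  obtain ⟨C, hC, h⟩ := exists_abs_hermiteGaussian_le n
  refine (integrableOn_const_mul_exp_mul_rpow ha (c := 1 / 8) (by norm_num)
    (C * Real.exp (|z| ^ 2 / 4))).mono' (aestronglyMeasurable_hermiteGaussian_mul_rpow a n z) ?_
  filter_upwards [ae_restrict_mem measurableSet_Ioi] with x hx
  have hx : 0 < x := hx
  rw [norm_mul, Real.norm_eq_abs, Real.norm_eq_abs, abs_of_nonneg (Real.rpow_nonneg hx.le a),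
    mul_assoc C]
  gcongr
  exact (h _).trans (by gcongr; exact exp_neg_add_sq_le x z _ le_rfl)

lemma hasDerivAt_hermiteIntegral {a : ℝ} (ha : -1 < a) (n : ℕ) (z : ℝ) :
    HasDerivAt (hermiteIntegral a n) (-hermiteIntegral a (n + 1) z) z := by
  obtain ⟨C, hC, h⟩ := exists_abs_hermiteGaussian_le (n + 1)
  have key := hasDerivAt_integral_of_dominated_loc_of_deriv_le (μ := volume.restrict (Ioi (0 : ℝ)))
    (F := fun (z x : ℝ) => hermiteGaussian n (x + z) * x ^ a)
    (F' := fun (z x : ℝ) => -hermiteGaussian (n + 1) (x + z) * x ^ a)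
    (bound := fun x => C * Real.exp ((|z| + 1) ^ 2 / 4) * Real.exp (-(1 / 8) * x ^ 2) * x ^ a)
    (Metric.ball_mem_nhds z one_pos)
    (Eventually.of_forall fun z' => aestronglyMeasurable_hermiteGaussian_mul_rpow a n z')
    (integrableOn_hermiteGaussian_mul_rpow ha n z)
    ((aestronglyMeasurable_hermiteGaussian_mul_rpow a (n + 1) z).neg.congr
      (ae_of_all _ fun x => by simp)) ?_
    (integrableOn_const_mul_exp_mul_rpow ha (by norm_num) _) ?_
  · refine key.2.congr_deriv ?_
    rw [hermiteIntegral, ← integral_neg]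
    simp
  · filter_upwards [ae_restrict_mem measurableSet_Ioi] with x hx z' hz'
    have hx : 0 < x := hx
    have hz'' : |z'| ≤ |z| + 1 := by
      rw [Metric.mem_ball, Real.dist_eq] at hz'
      have := abs_sub_abs_le_abs_sub z' z
      linarith
    rw [norm_mul, Real.norm_eq_abs, Real.norm_eq_abs, abs_of_nonneg (Real.rpow_nonneg hx.le a),
      mul_assoc C, abs_neg]
    gcongr
    exact (h _).trans (by gcongr; exact exp_neg_add_sq_le x z' _ hz'')
  · refine ae_of_all _ fun x z' _ => ?_
    have h1 : HasDerivAt (fun z' : ℝ => x + z') 1 z' := (hasDerivAt_id z').const_add x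
    have := ((hasDerivAt_hermiteGaussian n (x + z')).comp z' h1).mul_const (x ^ a)
    simpa using this

lemma continuous_hermiteIntegral {a : ℝ} (ha : -1 < a) (n : ℕ) :
    Continuous (hermiteIntegral a n) :=
  continuous_iff_continuousAt.2 fun z => (hasDerivAt_hermiteIntegral ha n z).continuousAt

lemma iteratedDeriv_hermiteIntegral {a : ℝ} (ha : -1 < a) (n : ℕ) :
    iteratedDeriv n (hermiteIntegral a 0) = fun z => (-1) ^ n * hermiteIntegral a n z := by
  induction n with
  | zero => simp
  | succ n ih =>
    rw [iteratedDeriv_succ, ih]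
    funext z
    rw [((hasDerivAt_hermiteIntegral ha n z).const_mul _).deriv]
    ring

/-- For exponents `-1 < a ≤ 0` the transform is bounded on the whole line; for `a > 0` and
`n = 0` it grows like `|z|^a` as `z → -∞`. -/
lemma exists_abs_hermiteIntegral_le {a : ℝ} (ha : -1 < a) (ha0 : a ≤ 0) (n : ℕ) :
    ∃ C : ℝ, ∀ z : ℝ, |hermiteIntegral a n z| ≤ C := by
  obtain ⟨C, hC, h⟩ := exists_abs_hermiteGaussian_le n
  have i1 : Integrable (fun x : ℝ => Real.exp (-(1 / 4) * x ^ 2)) :=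
    integrable_exp_neg_mul_sq (by norm_num)
  have i2 : IntegrableOn (fun x : ℝ => (Ioc (0 : ℝ) 1).indicator (fun x => x ^ a) x) (Ioi 0) := by
    refine Integrable.integrableOn ?_
    rw [integrable_indicator_iff measurableSet_Ioc]
    exact (intervalIntegrable_iff_integrableOn_Ioc_of_le zero_le_one).1
      (intervalIntegral.intervalIntegrable_rpow' ha)
  refine ⟨C * ((∫ x : ℝ, Real.exp (-(1 / 4) * x ^ 2)) +
    ∫ x in Ioi (0 : ℝ), (Ioc (0 : ℝ) 1).indicator (fun x => x ^ a) x), fun z => ?_⟩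
  have i1z : Integrable (fun x : ℝ => Real.exp (-(1 / 4) * (x + z) ^ 2)) := i1.comp_add_right z
  have hle : (∫ x in Ioi (0 : ℝ), Real.exp (-(1 / 4) * (x + z) ^ 2)) ≤
      ∫ x : ℝ, Real.exp (-(1 / 4) * x ^ 2) := by
    rw [← integral_add_right_eq_self (fun x : ℝ => Real.exp (-(1 / 4) * x ^ 2)) z]
    exact setIntegral_le_integral i1z (ae_of_all _ fun x => (Real.exp_pos _).le)
  calc |hermiteIntegral a n z|
      ≤ ∫ x in Ioi (0 : ℝ), C * (Real.exp (-(1 / 4) * (x + z) ^ 2) +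
          (Ioc (0 : ℝ) 1).indicator (fun x => x ^ a) x) := by
        rw [← Real.norm_eq_abs]
        refine norm_integral_le_of_norm_le ((i1z.integrableOn.add i2).const_mul C) ?_
        filter_upwards [ae_restrict_mem measurableSet_Ioi] with x hx
        have hx : 0 < x := hx
        rw [norm_mul, Real.norm_eq_abs, Real.norm_eq_abs,
          abs_of_nonneg (Real.rpow_nonneg hx.le a)]
        refine (mul_le_mul_of_nonneg_right (h _) (Real.rpow_nonneg hx.le a)).trans ?_
        rw [mul_assoc]
        refine mul_le_mul_of_nonneg_left ?_ hC
        have e : -(1 / 4) * (x + z) ^ 2 = -(x + z) ^ 2 / 4 := by ring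
        rw [e]
        have hpos := Real.exp_pos (-(x + z) ^ 2 / 4)
        have hxa := Real.rpow_nonneg hx.le a
        by_cases hx1 : x ≤ 1
        · rw [indicator_of_mem (show x ∈ Ioc (0 : ℝ) 1 from ⟨hx, hx1⟩)]
          have : Real.exp (-(x + z) ^ 2 / 4) ≤ 1 :=
            Real.exp_le_one_iff.2 (by have := sq_nonneg (x + z); linarith)
          nlinarith
        · rw [indicator_of_notMem (fun hm => hx1 hm.2), add_zero]
          have : x ^ a ≤ 1 := Real.rpow_le_one_of_one_le_of_nonpos (not_le.1 hx1).le ha0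
          nlinarith
    _ = C * ((∫ x in Ioi (0 : ℝ), Real.exp (-(1 / 4) * (x + z) ^ 2)) +
          ∫ x in Ioi (0 : ℝ), (Ioc (0 : ℝ) 1).indicator (fun x => x ^ a) x) := by
        rw [integral_const_mul, integral_add i1z.integrableOn i2]
    _ ≤ _ := by gcongr

lemma exists_abs_hermiteIntegral_le_exp {a : ℝ} (ha : -1 < a) (n : ℕ) :
    ∃ C : ℝ, ∀ z : ℝ, 0 ≤ z → |hermiteIntegral a n z| ≤ C * Real.exp (-z ^ 2 / 4) := by
  obtain ⟨C, hC, h⟩ := exists_abs_hermiteGaussian_le n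
  have i1 := integrableOn_const_mul_exp_mul_rpow ha (c := 1 / 4) (by norm_num) C
  refine ⟨∫ x in Ioi (0 : ℝ), C * Real.exp (-(1 / 4) * x ^ 2) * x ^ a, fun z hz => ?_⟩
  rw [← integral_mul_const, ← Real.norm_eq_abs]
  refine norm_integral_le_of_norm_le (i1.mul_const _) ?_
  filter_upwards [ae_restrict_mem measurableSet_Ioi] with x hx
  have hx : 0 < x := hx
  rw [norm_mul, Real.norm_eq_abs, Real.norm_eq_abs, abs_of_nonneg (Real.rpow_nonneg hx.le a)]
  calc _ ≤ C * (Real.exp (-(1 / 4) * x ^ 2) * Real.exp (-z ^ 2 / 4)) * x ^ a := by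
        gcongr
        refine (h _).trans ?_
        gcongr
        rw [← Real.exp_add]
        refine Real.exp_le_exp.2 ?_
        nlinarith [mul_nonneg hx.le hz]
    _ = _ := by ring

/-! ### Parabolic cylinder functions -/

/-- The order `p` is split as `p = n - a - 1` with `n` a natural number and `a > -1`; this is the
number `n` of derivatives used by `parabolicCylinder`. -/
noncomputable def cylinderDerivCount (p : ℝ) : ℕ := if p < 0 then 0 else ⌊p⌋₊ + 1

/-- The exponent `a > -1` in the splitting `p = n - a - 1`. -/
noncomputable def cylinderExponent (p : ℝ) : ℝ := cylinderDerivCount p - p - 1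

lemma neg_one_lt_cylinderExponent (p : ℝ) : -1 < cylinderExponent p := by
  unfold cylinderExponent cylinderDerivCount
  split_ifs with h
  · push_cast; linarith
  · have := Nat.lt_floor_add_one p
    push_cast; linarith

lemma cylinderExponent_nonpos {p : ℝ} (hp : 0 ≤ p) : cylinderExponent p ≤ 0 := by
  unfold cylinderExponent cylinderDerivCount
  rw [if_neg (not_lt.2 hp)]
  have := Nat.floor_le hp
  push_cast; linarith

lemma exp_mul_parabolicCylinderNeg (q z : ℝ) :
    Real.exp (-z ^ 2 / 4) * parabolicCylinderNeg q z =
      (Real.Gamma (-q))⁻¹ * hermiteIntegral (-q - 1) 0 z := by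
  have h : hermiteIntegral (-q - 1) 0 z = Real.exp (-z ^ 2 / 2) *
      ∫ x in Ioi (0 : ℝ), Real.exp (-x * z - x ^ 2 / 2) * x ^ (-q - 1) := by
    rw [hermiteIntegral, ← integral_const_mul]
    refine integral_congr_ae (ae_of_all _ fun x => ?_)
    simp only [hermiteGaussian_zero]
    rw [← mul_assoc, ← Real.exp_add]
    ring_nf
  have h2 : Real.exp (-z ^ 2 / 2) = Real.exp (-z ^ 2 / 4) * Real.exp (-z ^ 2 / 4) := by
    rw [← Real.exp_add]; ring_nf
  rw [h, parabolicCylinderNeg, h2]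
  ring

lemma exp_mul_parabolicCylinder (p z : ℝ) :
    Real.exp (-z ^ 2 / 4) * parabolicCylinder p z =
      (Real.Gamma (cylinderDerivCount p - p))⁻¹ *
        hermiteIntegral (cylinderExponent p) (cylinderDerivCount p) z := by
  have ha := neg_one_lt_cylinderExponent p
  unfold cylinderExponent at *
  by_cases hp : p < 0
  · have hn : cylinderDerivCount p = 0 := if_pos hp
    rw [hn, parabolicCylinder, if_pos hp, exp_mul_parabolicCylinderNeg]
    simp
  · have hn : cylinderDerivCount p = ⌊p⌋₊ + 1 := if_neg hp
    rw [parabolicCylinder, if_neg hp]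
    rw [hn] at ha ⊢
    set n := ⌊p⌋₊ + 1 with hn'
    have e : ((n : ℕ) : ℝ) = (⌊p⌋₊ : ℝ) + 1 := by rw [hn']; push_cast; rfl
    have hf : (fun w : ℝ => Real.exp (-w ^ 2 / 4) *
        parabolicCylinderNeg (p - (⌊p⌋₊ + 1)) w) =
        fun w => (Real.Gamma (n - p))⁻¹ * hermiteIntegral (n - p - 1) 0 w := by
      funext w
      rw [exp_mul_parabolicCylinderNeg, e, neg_sub]
    rw [hf, iteratedDeriv_const_mul_field, iteratedDeriv_hermiteIntegral ha n]
    have h1 : Real.exp (-z ^ 2 / 4) * Real.exp (z ^ 2 / 4) = 1 := by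
      rw [← Real.exp_add]; simp [neg_div]
    have h2 : ((-1 : ℝ) ^ n) * (-1) ^ n = 1 := by rw [← mul_pow]; simp
    linear_combination (Real.Gamma (n - p))⁻¹ * hermiteIntegral (n - p - 1) n z *
      ((-1) ^ n * (-1) ^ n * h1 + h2)

/-! ### The scaled kernel -/

/-- The parabolically scaled kernel `r^{-(n-a)/2} ∫₀^∞ He_n(u + z) e^{-(u + z)²/2} u^a du` with
`z = x / √r`. -/
noncomputable def hermiteKernel (a : ℝ) (n : ℕ) (r x : ℝ) : ℝ :=
  hermiteIntegral a n (x / √r) / r ^ (((n : ℝ) - a) / 2)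

lemma exp_mul_parabolicCylinder_div_rpow (p : ℝ) {r : ℝ} (hr : 0 < r) (x : ℝ) :
    Real.exp (-x ^ 2 / (4 * r)) * parabolicCylinder p (x / √r) / r ^ ((p + 1) / 2) =
      (Real.Gamma (cylinderDerivCount p - p))⁻¹ *
        hermiteKernel (cylinderExponent p) (cylinderDerivCount p) r x := by
  have e : -x ^ 2 / (4 * r) = -(x / √r) ^ 2 / 4 := by
    rw [div_pow, Real.sq_sqrt hr.le]
    field_simp
  have e2 : ((cylinderDerivCount p : ℝ) - cylinderExponent p) / 2 = (p + 1) / 2 := by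
    unfold cylinderExponent; ring
  rw [e, exp_mul_parabolicCylinder, hermiteKernel, e2, mul_div_assoc]

lemma hasDerivAt_hermiteKernel {a : ℝ} (ha : -1 < a) (n : ℕ) {r : ℝ} (hr : 0 < r) (x y : ℝ) :
    HasDerivAt (fun y => hermiteKernel a n r (x - y)) (hermiteKernel a (n + 1) r (x - y)) y := by
  have h1 : HasDerivAt (fun y : ℝ => (x - y) / √r) (-1 / √r) y :=
    ((hasDerivAt_id y).const_sub x).div_const _
  have h2 := ((hasDerivAt_hermiteIntegral ha n ((x - y) / √r)).comp y h1).div_const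
    (r ^ (((n : ℝ) - a) / 2))
  refine h2.congr_deriv ?_
  have e : r ^ ((((n + 1 : ℕ) : ℝ) - a) / 2) = √r * r ^ (((n : ℝ) - a) / 2) := by
    rw [Real.sqrt_eq_rpow, ← Real.rpow_add hr]
    congr 1
    push_cast; ring
  rw [hermiteKernel, e]
  have := (Real.sqrt_pos.2 hr).ne'
  have := (Real.rpow_pos_of_pos hr (((n : ℝ) - a) / 2)).ne'
  field_simp

lemma continuousOn_hermiteKernel {a : ℝ} (ha : -1 < a) (n : ℕ) :
    ContinuousOn (fun q : ℝ × ℝ => hermiteKernel a n q.1 q.2) {q | 0 < q.1} := by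
  intro q hq
  have hq : 0 < q.1 := hq
  refine ContinuousAt.continuousWithinAt ?_
  unfold hermiteKernel
  refine ContinuousAt.div ?_ ?_ (Real.rpow_pos_of_pos hq _).ne'
  · refine (continuous_hermiteIntegral ha n).continuousAt.comp ?_
    exact continuousAt_snd.div (Real.continuous_sqrt.continuousAt.comp continuousAt_fst)
      (Real.sqrt_pos.2 hq).ne'
  · exact continuousAt_fst.rpow_const (Or.inl hq.ne')

lemma exists_rpow_mul_exp_neg_le {m δ : ℝ} (hm : 0 ≤ m) (hδ : 0 < δ) :
    ∃ M : ℝ, ∀ r : ℝ, 0 < r → Real.exp (-δ / r) / r ^ m ≤ M := by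
  refine ⟨⌈m⌉₊.factorial / δ ^ ⌈m⌉₊ + 1, fun r hr => ?_⟩
  have hrm := Real.rpow_pos_of_pos hr m
  have hN : 0 ≤ (⌈m⌉₊.factorial : ℝ) / δ ^ ⌈m⌉₊ := by positivity
  have he1 : Real.exp (-δ / r) ≤ 1 := Real.exp_le_one_iff.2 (by
    rw [neg_div]; have := div_pos hδ hr; linarith)
  rw [div_le_iff₀ hrm]
  rcases le_total 1 r with h1 | h1
  · have := Real.one_le_rpow h1 hm
    nlinarith
  · have h := Real.pow_div_factorial_le_exp (δ / r) (by positivity) ⌈m⌉₊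
    have h2 : Real.exp (-δ / r) ≤ ⌈m⌉₊.factorial / δ ^ ⌈m⌉₊ * r ^ ⌈m⌉₊ := by
      rw [neg_div, Real.exp_neg]
      refine inv_le_of_inv_le₀ (by positivity) (le_trans (le_of_eq ?_) h)
      rw [div_pow]
      field_simp
    have h3 : r ^ ⌈m⌉₊ ≤ r ^ m := by
      rw [← Real.rpow_natCast]
      exact Real.rpow_le_rpow_of_exponent_ge hr h1 (Nat.le_ceil m)
    calc _ ≤ _ := h2
      _ ≤ ⌈m⌉₊.factorial / δ ^ ⌈m⌉₊ * r ^ m := by gcongr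
      _ ≤ _ := by nlinarith

/-- The kernel is bounded, uniformly in `y` near `y₀ < b t` and in `s ∈ (0, t)`. Away from `t` this
is boundedness of the transform (`a ≤ 0`), so the size of `b` near `0` does not matter; near `t`
the distance from `y` to the curve is bounded below and the Gaussian factor compensates the power
of `t - s`. -/
lemma exists_abs_hermiteKernel_le {a : ℝ} (ha : -1 < a) (ha0 : a ≤ 0) (n : ℕ) {b : ℝ → ℝ}
    (hb : ContinuousOn b (Ioi 0)) {t y₀ : ℝ} (ht : 0 < t) (hy : y₀ < b t) :
    ∃ M : ℝ, ∃ δ > 0, ∀ s ∈ Ioo 0 t, ∀ y ∈ Metric.ball y₀ δ,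
      |hermiteKernel a n (t - s) (b s - y)| ≤ M := by
  obtain ⟨C, hC⟩ := exists_abs_hermiteIntegral_le ha ha0 n
  obtain ⟨D, hD⟩ := exists_abs_hermiteIntegral_le_exp ha n
  have hC0 : 0 ≤ C := (abs_nonneg _).trans (hC 0)
  have hD0 : 0 ≤ D := by
    have := (abs_nonneg _).trans (hD 0 le_rfl)
    simpa using this
  set m := ((n : ℝ) - a) / 2 with hm
  have hm0 : 0 ≤ m := by have : (0 : ℝ) ≤ n := n.cast_nonneg; rw [hm]; linarith
  set δ := (b t - y₀) / 3 with hδ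
  have hδ0 : 0 < δ := by rw [hδ]; linarith
  obtain ⟨M, hM⟩ := exists_rpow_mul_exp_neg_le hm0 (δ := δ ^ 2 / 4) (by positivity)
  have hbt : ContinuousAt b t := hb.continuousAt (Ioi_mem_nhds ht)
  obtain ⟨η, hη, hbη⟩ := Metric.continuousAt_iff.1 hbt δ hδ0
  have hηm := Real.rpow_pos_of_pos hη m
  refine ⟨max (C / η ^ m) (D * M), δ, hδ0, fun s hs y hy' => ?_⟩
  have hr : 0 < t - s := by linarith [hs.2]
  have hrm := Real.rpow_pos_of_pos hr m
  rw [hermiteKernel, abs_div, abs_of_pos hrm]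
  by_cases hsη : η ≤ t - s
  · refine le_max_of_le_left ?_
    have := Real.rpow_le_rpow hη.le hsη hm0
    exact div_le_div₀ hC0 (hC _) hηm this
  · refine le_max_of_le_right ?_
    have h1 := hbη (x := s) (by rw [Real.dist_eq, abs_sub_comm, abs_of_pos hr]; linarith)
    rw [Real.dist_eq] at h1
    rw [Metric.mem_ball, Real.dist_eq] at hy'
    have h2 : δ ≤ b s - y := by
      have := (abs_lt.1 h1).1
      have := (abs_lt.1 hy').2
      rw [hδ] at *
      linarith
    have hsq := Real.sqrt_pos.2 hr
    have h3 := hD ((b s - y) / √(t - s)) (div_nonneg (by linarith) hsq.le)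
    have h4 : Real.exp (-((b s - y) / √(t - s)) ^ 2 / 4) ≤
        Real.exp (-(δ ^ 2 / 4) / (t - s)) := by
      refine Real.exp_le_exp.2 ?_
      rw [div_pow, Real.sq_sqrt hr.le, neg_div, neg_div, neg_le_neg_iff, div_div, div_div,
        mul_comm (4 : ℝ)]
      gcongr
    calc _ ≤ D * Real.exp (-(δ ^ 2 / 4) / (t - s)) / (t - s) ^ m := by
          gcongr
          exact h3.trans (by gcongr)
      _ = D * (Real.exp (-(δ ^ 2 / 4) / (t - s)) / (t - s) ^ m) := by ring
      _ ≤ D * M := by gcongr; exact hM _ hr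

/-! ### First passage times of continuous paths -/

lemma firstPassageTime_lt_iff {Ω : Type*} (W : ℝ≥0 → Ω → ℝ) (b : ℝ → ℝ) (ω : Ω) (s : ℝ≥0∞) :
    firstPassageTime W b ω < s ↔ ∃ u : ℝ≥0, 0 < u ∧ (u : ℝ≥0∞) < s ∧ W u ω ≤ b u := by
  rw [firstPassageTime, sInf_lt_iff]
  constructor
  · rintro ⟨_, ⟨u, ⟨hu, hWu⟩, rfl⟩, hlt⟩
    exact ⟨u, hu, hlt, hWu⟩
  · rintro ⟨u, hu, hlt, hWu⟩
    exact ⟨u, ⟨u, ⟨hu, hWu⟩, rfl⟩, hlt⟩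

lemma measurableSet_exists_mem_nonpos {Ω T : Type*} [TopologicalSpace T]
    [SecondCountableTopology T] {m : MeasurableSpace Ω} {K : Set T} (hK : IsCompact K)
    {h : T → Ω → ℝ} (hc : ∀ ω, ContinuousOn (h · ω) K) (hm : ∀ u ∈ K, Measurable (h u)) :
    MeasurableSet {ω | ∃ u ∈ K, h u ω ≤ 0} := by
  rcases K.eq_empty_or_nonempty with rfl | hne
  · simp
  have := hne.to_subtype
  -- by compactness `h` has a zero or negative value iff its values on a dense sequence come
  -- arbitrarily close to `(-∞, 0]`
  have : {ω | ∃ u ∈ K, h u ω ≤ 0} =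
      ⋂ k : ℕ, ⋃ i : ℕ, {ω | h (TopologicalSpace.denseSeq K i) ω < 1 / ((k : ℝ) + 1)} := by
    ext ω
    have hcω : Continuous (fun u : K => h u ω) := continuousOn_iff_continuous_domRestrict.1 (hc ω)
    simp only [mem_ofPred_eq, mem_iInter, mem_iUnion]
    constructor
    · rintro ⟨u, hu, hle⟩ k
      have ho : IsOpen {u : K | h u ω < 1 / ((k : ℝ) + 1)} := isOpen_lt hcω continuous_const
      obtain ⟨i, hi⟩ := (TopologicalSpace.denseRange_denseSeq K).exists_mem_open ho
        ⟨⟨u, hu⟩, lt_of_le_of_lt hle Nat.one_div_pos_of_nat⟩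
      exact ⟨i, hi⟩
    · intro H
      obtain ⟨u, hu, hmin⟩ := hK.exists_isMinOn hne (hc ω)
      refine ⟨u, hu, le_of_forall_pos_le_add fun ε hε => ?_⟩
      obtain ⟨k, hk⟩ := exists_nat_one_div_lt hε
      obtain ⟨i, hi⟩ := H k
      have := isMinOn_iff.1 hmin _ (TopologicalSpace.denseSeq K i).2
      linarith
  rw [this]
  exact MeasurableSet.iInter fun k => MeasurableSet.iUnion fun i =>
    measurableSet_lt (hm _ (TopologicalSpace.denseSeq K i).2) measurable_const

lemma continuousAt_path_sub_boundary {w : ℝ≥0 → ℝ} (hw : Continuous w) {b : ℝ → ℝ}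
    (hb : ContinuousOn b (Ioi 0)) {u : ℝ≥0} (hu : 0 < u) :
    ContinuousAt (fun v : ℝ≥0 => w v - b v) u :=
  hw.continuousAt.sub (ContinuousAt.comp (f := fun v : ℝ≥0 => (v : ℝ)) (g := b)
    (hb.continuousAt (Ioi_mem_nhds (NNReal.coe_pos.2 hu))) NNReal.continuous_coe.continuousAt)

/-- The event `{τ < s}` only depends on the path before time `s`. -/
lemma measurableSet_firstPassageTime_lt {Ω : Type*} {m : MeasurableSpace Ω} {W : ℝ≥0 → Ω → ℝ}
    {b : ℝ → ℝ} (hb : ContinuousOn b (Ioi 0)) (hc : ∀ ω, Continuous (W · ω)) {s : ℝ≥0∞}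
    (hm : ∀ u : ℝ≥0, (u : ℝ≥0∞) < s → Measurable (W u)) :
    MeasurableSet {ω | firstPassageTime W b ω < s} := by
  have : {ω | firstPassageTime W b ω < s} =
      ⋃ (p : ℚ) (q : ℚ) (_ : 0 < Real.toNNReal p) (_ : (Real.toNNReal q : ℝ≥0∞) < s),
        {ω | ∃ u ∈ Icc (Real.toNNReal p) (Real.toNNReal q), W u ω - b u ≤ 0} := by
    ext ω
    simp only [mem_ofPred_eq, firstPassageTime_lt_iff, mem_iUnion]
    constructor
    · rintro ⟨u, hu, hus, hle⟩
      obtain ⟨p, -, hp, hpu⟩ := ENNReal.lt_iff_exists_rat_btwn.1 (ENNReal.coe_pos.2 hu)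
      obtain ⟨q, -, huq, hq⟩ := ENNReal.lt_iff_exists_rat_btwn.1 hus
      exact ⟨p, q, ENNReal.coe_pos.1 hp, hq, u,
        ⟨(ENNReal.coe_lt_coe.1 hpu).le, (ENNReal.coe_lt_coe.1 huq).le⟩, sub_nonpos.2 hle⟩
    · rintro ⟨p, q, hp, hq, u, hu, hle⟩
      exact ⟨u, hp.trans_le hu.1, (ENNReal.coe_le_coe.2 hu.2).trans_lt hq, sub_nonpos.1 hle⟩
  rw [this]
  refine MeasurableSet.iUnion fun p => MeasurableSet.iUnion fun q => MeasurableSet.iUnion fun hp =>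
    MeasurableSet.iUnion fun hq => measurableSet_exists_mem_nonpos isCompact_Icc (fun ω => ?_)
      fun u hu => (hm u ((ENNReal.coe_le_coe.2 hu.2).trans_lt hq)).sub_const _
  exact fun u hu => (continuousAt_path_sub_boundary (hc ω) hb
    (hp.trans_le hu.1)).continuousWithinAt

lemma measurable_firstPassageTime {Ω : Type*} {m : MeasurableSpace Ω} {W : ℝ≥0 → Ω → ℝ}
    {b : ℝ → ℝ} (hb : ContinuousOn b (Ioi 0)) (hc : ∀ ω, Continuous (W · ω))
    (hm : ∀ u, Measurable (W u)) : Measurable (firstPassageTime W b) :=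
  measurable_of_Iio fun _ => measurableSet_firstPassageTime_lt hb hc fun u _ => hm u

lemma firstPassageTime_lt_of_lt {Ω : Type*} {W : ℝ≥0 → Ω → ℝ} {b : ℝ → ℝ}
    (hb : ContinuousOn b (Ioi 0)) {ω : Ω} (hc : Continuous (W · ω)) {u : ℝ≥0} (hu : 0 < u)
    (h : W u ω < b u) : firstPassageTime W b ω < u := by
  rw [firstPassageTime_lt_iff]
  have h1 : ∀ᶠ v in 𝓝 u, W v ω - b v < 0 :=
    (continuousAt_path_sub_boundary hc hb hu).eventually_lt_const (sub_neg.2 h)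
  obtain ⟨l, hl, hlu⟩ := exists_Ioc_subset_of_mem_nhds h1 ⟨0, hu⟩
  obtain ⟨v, hv1, hv2⟩ := exists_between hl
  refine ⟨v, bot_le.trans_lt hv1, ENNReal.coe_lt_coe.2 hv2, ?_⟩
  exact (sub_neg.1 (hlu ⟨hv1, hv2.le⟩)).le

/-- A continuous path sits on the boundary at a positive finite first passage time. -/
lemma apply_firstPassageTime {Ω : Type*} {W : ℝ≥0 → Ω → ℝ} {b : ℝ → ℝ}
    (hb : ContinuousOn b (Ioi 0)) {ω : Ω} (hc : Continuous (W · ω)) {u : ℝ≥0} (hu : 0 < u)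
    (h : firstPassageTime W b ω = u) : W u ω = b u := by
  refine le_antisymm (not_lt.1 fun hlt => ?_) (not_lt.1 fun hlt => ?_)
  · have h1 : ∀ᶠ v in 𝓝 u, 0 < W v ω - b v :=
      (continuousAt_path_sub_boundary hc hb hu).eventually_const_lt (sub_pos.2 hlt)
    obtain ⟨r, hr, hur⟩ := exists_Ico_subset_of_mem_nhds h1 ⟨u + 1, by simp⟩
    have h2 : firstPassageTime W b ω < r := by rw [h]; exact ENNReal.coe_lt_coe.2 hr
    obtain ⟨v, hv, hvr, hle⟩ := (firstPassageTime_lt_iff W b ω r).1 h2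
    have huv : u ≤ v := by
      by_contra hvu
      have := (firstPassageTime_lt_iff W b ω u).2
        ⟨v, hv, ENNReal.coe_lt_coe.2 (not_le.1 hvu), hle⟩
      exact this.ne h
    have := hur ⟨huv, ENNReal.coe_lt_coe.1 hvr⟩
    exact (sub_pos.1 this).not_ge hle
  · exact (firstPassageTime_lt_of_lt hb hc hu hlt).ne h

/-! ### The Markov property at the first passage time -/

/-- The heat semigroup `f ↦ E f(x + √r N)`, with `N` standard Gaussian; for `r < 0` this is
`f x`. -/
noncomputable def gaussianSmoothing (f : ℝ → ℝ) (r x : ℝ) : ℝ :=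
  ∫ n, f (x + √r * n) ∂gaussianReal 0 1

lemma continuous_gaussianSmoothing (f : BoundedContinuousFunction ℝ ℝ) :
    Continuous fun q : ℝ × ℝ => gaussianSmoothing f q.1 q.2 := by
  refine continuous_of_dominated (bound := fun _ => ‖f‖) (fun q => ?_) (fun q => ?_)
    (integrable_const _) (ae_of_all _ fun n => ?_)
  · exact (f.continuous.comp (by fun_prop)).aestronglyMeasurable
  · exact ae_of_all _ fun n => f.norm_coe_le_norm _
  · exact f.continuous.comp (by fun_prop)

lemma abs_gaussianSmoothing_le (f : BoundedContinuousFunction ℝ ℝ) (r x : ℝ) :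
    ‖gaussianSmoothing f r x‖ ≤ ‖f‖ := by
  refine (norm_integral_le_of_norm_le_const (ae_of_all _ fun n => f.norm_coe_le_norm _)).trans ?_
  simp

lemma gaussianReal_map_sqrt_mul (v : ℝ≥0) :
    (gaussianReal 0 1).map (fun n => √(v : ℝ) * n) = gaussianReal 0 v := by
  rw [gaussianReal_map_const_mul, mul_zero, mul_one]
  congr 1
  exact NNReal.eq (Real.sq_sqrt v.2)

/-- The simple Markov property at a fixed time `s`, on an event of the past. -/
lemma setIntegral_comp_brownian {Ω : Type*} [MeasurableSpace Ω] {P : Measure Ω}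
    {W : ℝ≥0 → Ω → ℝ} (hW : IsPreBrownianReal W P) (hm : ∀ u, Measurable (W u)) {s t : ℝ≥0}
    (hst : s ≤ t) {A : Set Ω}
    (hA : MeasurableSet[MeasurableSpace.comap (fun ω (u : Set.Iic s) => W u ω) inferInstance] A)
    (f : BoundedContinuousFunction ℝ ℝ) :
    ∫ ω in A, f (W t ω) ∂P = ∫ ω in A, gaussianSmoothing f ((t : ℝ) - s) (W s ω) ∂P := by
  have := hW.isGaussianProcess.isProbabilityMeasure
  obtain ⟨B, hB, rfl⟩ := hA
  set X : Ω → (Set.Iic s → ℝ) := fun ω u => W u ω with hX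
  set D : Ω → ℝ := fun ω => W t ω - W s ω with hD
  have mX : Measurable X := measurable_pi_lambda _ fun u => hm u
  have mD : Measurable D := (hm t).sub (hm s)
  have hind : IndepFun X D P := by
    have mev : Measurable fun d : ℝ≥0 → ℝ => d (t - s) := measurable_pi_apply (t - s)
    have h := (hW.indepFun_shift s).symm.comp (φ := id) (ψ := fun d : ℝ≥0 → ℝ => d (t - s))
      measurable_id mev
    have e : (fun d : ℝ≥0 → ℝ => d (t - s)) ∘ (fun ω t => W (s + t) ω - W s ω) = D := by
      funext ω
      simp [hD, add_tsub_cancel_of_le hst]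
    rw [e] at h
    exact h
  have hlaw : P.map D = (gaussianReal 0 1).map (fun n => √((t : ℝ) - s) * n) := by
    have h := (hW.hasLaw_sub t s).map_eq
    have e : nndist (t : ℝ) (s : ℝ) = t - s := by
      refine NNReal.eq ?_
      rw [coe_nndist, Real.dist_eq, NNReal.coe_sub hst, abs_of_nonneg]
      simpa using hst
    rw [← NNReal.coe_sub hst, gaussianReal_map_sqrt_mul, ← e]
    exact h
  set G : (Set.Iic s → ℝ) × ℝ → ℝ :=
    fun q => B.indicator (fun x => f (x ⟨s, Set.mem_Iic.2 le_rfl⟩ + q.2)) q.1 with hG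
  have mG : Measurable G := by
    have : G = (Prod.fst ⁻¹' B).indicator
        (fun q : (Set.Iic s → ℝ) × ℝ => f (q.1 ⟨s, Set.mem_Iic.2 le_rfl⟩ + q.2)) := by
      funext q
      simp only [hG, indicator]
      rfl
    rw [this]
    refine Measurable.indicator ?_ (measurable_fst hB)
    exact f.continuous.measurable.comp
      (((measurable_pi_apply _).comp measurable_fst).add measurable_snd)
  have hGb : ∀ q, ‖G q‖ ≤ ‖f‖ := fun q =>
    (norm_indicator_le_norm_self _ _).trans (f.norm_coe_le_norm _)
  have hp := (indepFun_iff_map_prod_eq_prod_map_map mX.aemeasurable mD.aemeasurable).1 hind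
  have := Measure.isProbabilityMeasure_map (μ := P) mX.aemeasurable
  have := Measure.isProbabilityMeasure_map (μ := P) mD.aemeasurable
  have hGi : Integrable G ((P.map X).prod (P.map D)) :=
    Integrable.of_bound mG.aestronglyMeasurable ‖f‖ (ae_of_all _ hGb)
  calc ∫ ω in X ⁻¹' B, f (W t ω) ∂P = ∫ ω, G (X ω, D ω) ∂P := by
        rw [← integral_indicator (mX hB)]
        refine integral_congr_ae (ae_of_all _ fun ω => ?_)
        by_cases hω : X ω ∈ B
        · simp only [hG, indicator, hω, mem_preimage, if_true]
          simp [hX, hD]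
        · simp only [hG, indicator, hω, mem_preimage, if_false]
    _ = ∫ q, G q ∂((P.map X).prod (P.map D)) := by
        rw [← hp, integral_map (mX.prodMk mD).aemeasurable mG.aestronglyMeasurable]
    _ = ∫ x, ∫ d, G (x, d) ∂(P.map D) ∂(P.map X) := integral_prod _ hGi
    _ = ∫ ω, ∫ d, G (X ω, d) ∂(P.map D) ∂P := by
        rw [integral_map mX.aemeasurable hGi.aestronglyMeasurable.integral_prod_right']
    _ = ∫ ω, (X ⁻¹' B).indicator
          (fun ω => gaussianSmoothing f ((t : ℝ) - s) (W s ω)) ω ∂P := by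
        refine integral_congr_ae (ae_of_all _ fun ω => ?_)
        by_cases hω : X ω ∈ B
        · simp only [hG, indicator, hω, mem_preimage, if_true]
          have hfc : Continuous fun d => f (X ω ⟨s, Set.mem_Iic.2 le_rfl⟩ + d) :=
            f.continuous.comp (continuous_const.add continuous_id)
          rw [hlaw, integral_map (by fun_prop) hfc.aestronglyMeasurable]
          rfl
        · simp only [hG, indicator, hω, mem_preimage, if_false, integral_zero]
    _ = _ := integral_indicator (mX hB)

/-- The first point of the grid `{k t / N}` strictly after time `u`, for `t, N > 0`. -/
noncomputable def nextGridPoint (t : ℝ≥0) (N : ℕ) (u : ℝ≥0) : ℝ≥0 :=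
  t * ((⌊N * u / t⌋₊ : ℝ≥0) + 1) / N

lemma tendsto_nextGridPoint {t : ℝ≥0} (ht : 0 < t) (u : ℝ≥0) :
    Tendsto (fun N : ℕ => nextGridPoint t (N + 1) u) atTop (𝓝 u) := by
  have h1 : Tendsto (fun N : ℕ => (u : ℝ) + t * (1 / ((N : ℝ) + 1))) atTop (𝓝 u) := by
    have := (tendsto_one_div_add_atTop_nhds_zero_nat (𝕜 := ℝ)).const_mul (t : ℝ)
    simpa using this.const_add (u : ℝ)
  rw [← NNReal.tendsto_coe]
  have ht' : (0 : ℝ) < t := ht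
  refine tendsto_of_tendsto_of_tendsto_of_le_of_le tendsto_const_nhds h1 (fun N => ?_) fun N => ?_
  · have hN : (0 : ℝ) < (N : ℝ) + 1 := by positivity
    have h := (Nat.lt_floor_add_one (((N + 1 : ℕ) : ℝ≥0) * u / t))
    have h : (((N : ℝ) + 1) * u / t) < (⌊((N + 1 : ℕ) : ℝ≥0) * u / t⌋₊ : ℝ) + 1 := by
      exact_mod_cast h
    simp only [nextGridPoint]
    push_cast at h ⊢
    rw [div_lt_iff₀ ht'] at h
    rw [le_div_iff₀ hN]
    linarith
  · have hN : (0 : ℝ) < (N : ℝ) + 1 := by positivity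
    have h := (Nat.floor_le (a := ((N + 1 : ℕ) : ℝ≥0) * u / t) (zero_le))
    have h : (⌊((N + 1 : ℕ) : ℝ≥0) * u / t⌋₊ : ℝ) ≤ (((N : ℝ) + 1) * u / t) := by
      exact_mod_cast h
    simp only [nextGridPoint]
    push_cast at h ⊢
    rw [le_div_iff₀ ht'] at h
    rw [div_le_iff₀ hN]
    have : (↑u + ↑t * (1 / ((N : ℝ) + 1))) * (N + 1) = u * (N + 1) + t := by field_simp
    rw [this]
    linarith

lemma measurable_nextGridPoint (t : ℝ≥0) (N : ℕ) : Measurable (nextGridPoint t N) := by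
  unfold nextGridPoint
  have : Measurable fun u : ℝ≥0 => (⌊N * u / t⌋₊ : ℝ≥0) :=
    (measurable_from_nat (f := fun k : ℕ => (k : ℝ≥0))).comp
      (Nat.measurable_floor.comp (by fun_prop))
  fun_prop

/-- The Markov property at the first passage time `τ`: on `{τ < t}` the conditional law of `W t`
is Gaussian around `W τ` with variance `t - τ`. The time `τ` is approximated from the right by
times with values in a finite grid. -/
lemma setIntegral_firstPassageTime_lt {Ω : Type*} [MeasurableSpace Ω] {P : Measure Ω}
    {W : ℝ≥0 → Ω → ℝ} (hW : IsPreBrownianReal W P) (hm : ∀ u, Measurable (W u))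
    (hc : ∀ ω, Continuous (W · ω)) {b : ℝ → ℝ} (hb : ContinuousOn b (Ioi 0)) {t : ℝ≥0}
    (ht : 0 < t) (f : BoundedContinuousFunction ℝ ℝ) :
    ∫ ω in {ω | firstPassageTime W b ω < t}, f (W t ω) ∂P =
      ∫ ω in {ω | firstPassageTime W b ω < t},
        gaussianSmoothing f ((t : ℝ) - (firstPassageTime W b ω).toNNReal)
          (W (firstPassageTime W b ω).toNNReal ω) ∂P := by
  have := hW.isGaussianProcess.isProbabilityMeasure
  set τ := firstPassageTime W b with hτ
  have mτ : Measurable τ := measurable_firstPassageTime hb hc hm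
  set T : Ω → ℝ≥0 := fun ω => (τ ω).toNNReal with hT
  have mT : Measurable T := mτ.ennreal_toNNReal
  have mW : Measurable (fun q : ℝ≥0 × Ω => W q.1 q.2) :=
    measurable_uncurry_of_continuous_of_measurable hc hm
  have mg := (continuous_gaussianSmoothing f).measurable
  set Φ : (Ω → ℝ≥0) → Ω → ℝ := fun S ω => gaussianSmoothing f ((t : ℝ) - S ω) (W (S ω) ω) with hΦ
  have mΦ : ∀ S : Ω → ℝ≥0, Measurable S → Measurable (Φ S) := fun S mS =>
    mg.comp ((measurable_const.sub mS.coe_nnreal_real).prodMk (mW.comp (mS.prodMk measurable_id)))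
  set σ : ℕ → Ω → ℝ≥0 := fun N ω => nextGridPoint t (N + 1) (T ω) with hσ
  have mσ : ∀ N, Measurable (σ N) := fun N => (measurable_nextGridPoint t (N + 1)).comp mT
  have step : ∀ N : ℕ, ∫ ω in {ω | τ ω < t}, Φ (σ N) ω ∂P =
      ∫ ω in {ω | τ ω < t}, f (W t ω) ∂P := by
    intro N
    set s : ℕ → ℝ≥0 := fun k => t * k / ((N + 1 : ℕ) : ℝ≥0) with hs
    set A : ℕ → Set Ω := fun k => {ω | τ ω < s (k + 1)} \ {ω | τ ω < s k} with hAdef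
    have hN : (0 : ℝ≥0) < ((N + 1 : ℕ) : ℝ≥0) := by positivity
    have hsmono : Monotone s := fun i j hij => by
      simp only [hs]; gcongr
    have hs0 : s 0 = 0 := by simp [hs]
    have hsN : s (N + 1) = t := by simp only [hs]; field_simp
    have mA : ∀ k, MeasurableSet (A k) := fun k =>
      (mτ measurableSet_Iio).diff (mτ measurableSet_Iio)
    have hfloor : ∀ k, ∀ ω ∈ A k, ⌊((N + 1 : ℕ) : ℝ≥0) * T ω / t⌋₊ = k := by
      rintro k ω ⟨h1, h2⟩
      have h1 : τ ω < s (k + 1) := h1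
      have h2 : ¬ τ ω < s k := h2
      have hfin : τ ω = (T ω : ℝ≥0∞) := (ENNReal.coe_toNNReal (h1.trans ENNReal.coe_lt_top).ne).symm
      rw [hfin, ENNReal.coe_lt_coe] at h1 h2
      rw [not_lt] at h2
      rw [Nat.floor_eq_iff zero_le]
      simp only [hs] at h1 h2
      rw [lt_div_iff₀ hN] at h1
      rw [div_le_iff₀ hN] at h2
      rw [le_div_iff₀ ht, div_lt_iff₀ ht]
      push_cast at h1 h2 ⊢
      constructor
      · linarith
      · linarith
    have hσA : ∀ k, ∀ ω ∈ A k, σ N ω = s (k + 1) := fun k ω hω => by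
      simp only [hσ, nextGridPoint, hfloor k ω hω, hs]
      push_cast; rfl
    have hunion : {ω | τ ω < t} = ⋃ k ∈ Finset.range (N + 1), A k := by
      ext ω
      simp only [mem_ofPred_eq, mem_iUnion, Finset.mem_range, exists_prop]
      constructor
      · intro h
        -- the last grid point not exceeding `τ ω`
        have hex : ∃ k, τ ω < s k := ⟨N + 1, by rwa [hsN]⟩
        classical
        have h0 : Nat.find hex ≠ 0 := fun h0 => by
          have := Nat.find_spec hex
          rw [h0, hs0] at this
          simp at this
        obtain ⟨k, hk⟩ := Nat.exists_eq_succ_of_ne_zero h0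
        have hle : Nat.find hex ≤ N + 1 := Nat.find_min' hex (by rwa [hsN])
        refine ⟨k, by omega, ?_, ?_⟩
        · have := Nat.find_spec hex
          rw [hk] at this
          exact this
        · exact Nat.find_min hex (by omega)
      · rintro ⟨k, hk, h1, -⟩
        refine lt_of_lt_of_le h1 (ENNReal.coe_le_coe.2 ?_)
        rw [← hsN]
        exact hsmono (by omega)
    have hdisj : Pairwise (Function.onFun Disjoint A) := by
      intro i j hij
      refine Set.disjoint_left.2 fun ω hi hj => hij ?_
      rw [← hfloor i ω hi, hfloor j ω hj]
    have int1 : Integrable (Φ (σ N)) P := Integrable.of_bound (mΦ _ (mσ N)).aestronglyMeasurable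
      ‖f‖ (ae_of_all _ fun ω => abs_gaussianSmoothing_le f _ _)
    have int2 : Integrable (fun ω => f (W t ω)) P := Integrable.of_bound
      (f.continuous.measurable.comp (hm t)).aestronglyMeasurable ‖f‖
      (ae_of_all _ fun ω => f.norm_coe_le_norm _)
    rw [hunion, integral_biUnion_finset _ (fun k _ => mA k) (hdisj.set_pairwise _)
        (fun k _ => int1.integrableOn),
      integral_biUnion_finset _ (fun k _ => mA k) (hdisj.set_pairwise _)
        (fun k _ => int2.integrableOn)]
    refine Finset.sum_congr rfl fun k hk => ?_
    have hkN : s (k + 1) ≤ t := by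
      rw [← hsN]; exact hsmono (by have := Finset.mem_range.1 hk; omega)
    have mpast : ∀ v ≤ s (k + 1), MeasurableSet[MeasurableSpace.comap
        (fun ω (u : Set.Iic (s (k + 1))) => W u ω) inferInstance] {ω | τ ω < v} := by
      intro v hv
      refine measurableSet_firstPassageTime_lt hb hc fun u hu => ?_
      have hu : u ≤ s (k + 1) := (ENNReal.coe_lt_coe.1 hu).le.trans hv
      exact (measurable_pi_apply (⟨u, hu⟩ : Set.Iic (s (k + 1)))).comp
        (comap_measurable (fun ω (u : Set.Iic (s (k + 1))) => W u ω))
    rw [setIntegral_comp_brownian hW hm hkN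
      ((mpast _ le_rfl).diff (mpast _ (hsmono k.le_succ))) f]
    refine setIntegral_congr_fun (mA k) fun ω hω => ?_
    simp only [hΦ, hσA k ω hω]
  have hlim : Tendsto (fun N => ∫ ω in {ω | τ ω < t}, Φ (σ N) ω ∂P) atTop
      (𝓝 (∫ ω in {ω | τ ω < t}, Φ T ω ∂P)) := by
    refine tendsto_integral_of_dominated_convergence (fun _ => ‖f‖)
      (fun N => (mΦ _ (mσ N)).aestronglyMeasurable) (integrable_const _)
      (fun N => ae_of_all _ fun ω => abs_gaussianSmoothing_le f _ _) (ae_of_all _ fun ω => ?_)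
    have h1 : Tendsto (fun N => σ N ω) atTop (𝓝 (T ω)) := tendsto_nextGridPoint ht (T ω)
    have h2 : Continuous fun u : ℝ≥0 => gaussianSmoothing f ((t : ℝ) - u) (W u ω) :=
      (continuous_gaussianSmoothing f).comp
        ((continuous_const.sub NNReal.continuous_coe).prodMk (hc ω))
    exact (h2.tendsto _).comp h1
  simp_rw [step] at hlim
  exact tendsto_nhds_unique tendsto_const_nhds hlim

lemma setLIntegral_firstPassageTime_lt {Ω : Type*} [MeasurableSpace Ω] {P : Measure Ω}
    {W : ℝ≥0 → Ω → ℝ} (hW : IsPreBrownianReal W P) (hm : ∀ u, Measurable (W u))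
    (hc : ∀ ω, Continuous (W · ω)) {b : ℝ → ℝ} (hb : ContinuousOn b (Ioi 0)) {t : ℝ≥0}
    (ht : 0 < t) {f : ℝ → ℝ≥0∞} (hf : Measurable f) :
    ∫⁻ ω in {ω | firstPassageTime W b ω < t}, f (W t ω) ∂P =
      ∫⁻ ω in {ω | firstPassageTime W b ω < t},
        ∫⁻ n, f (W (firstPassageTime W b ω).toNNReal ω +
          √((t : ℝ) - (firstPassageTime W b ω).toNNReal) * n) ∂gaussianReal 0 1 ∂P := by
  have := hW.isGaussianProcess.isProbabilityMeasure
  have key := setIntegral_firstPassageTime_lt hW hm hc hb ht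
  set τ := firstPassageTime W b with hτ
  have mτ : Measurable τ := measurable_firstPassageTime hb hc hm
  set T : Ω → ℝ≥0 := fun ω => (τ ω).toNNReal with hT
  have mT : Measurable T := mτ.ennreal_toNNReal
  have mW : Measurable (fun q : ℝ≥0 × Ω => W q.1 q.2) :=
    measurable_uncurry_of_continuous_of_measurable hc hm
  have mWT : Measurable fun ω => W (T ω) ω := mW.comp (mT.prodMk measurable_id)
  set μ := P.restrict {ω | τ ω < t}
  set Ψ : Ω × ℝ → ℝ := fun q => W (T q.1) q.1 + √((t : ℝ) - T q.1) * q.2 with hΨ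
  have mΨ : Measurable Ψ := by
    refine (mWT.comp measurable_fst).add (Measurable.mul ?_ measurable_snd)
    exact (measurable_const.sub (mT.coe_nnreal_real.comp measurable_fst)).sqrt
  have hmeas : μ.map (W t) = (μ.prod (gaussianReal 0 1)).map Ψ := by
    refine ext_of_forall_integral_eq_of_IsFiniteMeasure fun f => ?_
    rw [integral_map (hm t).aemeasurable f.continuous.aestronglyMeasurable,
      integral_map mΨ.aemeasurable f.continuous.aestronglyMeasurable, integral_prod]
    · exact key f
    · exact Integrable.of_bound (f.continuous.measurable.comp mΨ).aestronglyMeasurable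
        ‖f‖ (ae_of_all _ fun ω => f.norm_coe_le_norm _)
  calc _ = ∫⁻ x, f x ∂(μ.map (W t)) := (lintegral_map hf (hm t)).symm
    _ = ∫⁻ q, f (Ψ q) ∂(μ.prod (gaussianReal 0 1)) := by rw [hmeas, lintegral_map hf mΨ]
    _ = _ := lintegral_prod _ (hf.comp mΨ).aemeasurable

/-! ### Measurable modification and the law of the first passage time -/

/-- A process with almost surely continuous paths and almost everywhere measurable marginals
agrees, off a null set and simultaneously in all times, with one that is measurable and has only
continuous paths. -/
lemma exists_measurable_continuous_modification {Ω : Type*} [MeasurableSpace Ω] {P : Measure Ω}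
    {W : ℝ≥0 → Ω → ℝ} (hm : ∀ t, AEMeasurable (W t) P) (hc : ∀ᵐ ω ∂P, Continuous (W · ω)) :
    ∃ V : ℝ≥0 → Ω → ℝ, (∀ t, Measurable (V t)) ∧ (∀ ω, Continuous (V · ω)) ∧
      ∀ᵐ ω ∂P, ∀ t, W t ω = V t ω := by
  set d := TopologicalSpace.denseSeq ℝ≥0 with hd
  have hgood : ∀ᵐ ω ∂P, Continuous (W · ω) ∧ ∀ i, W (d i) ω = (hm (d i)).mk _ ω :=
    hc.and (ae_all_iff.2 fun i => (hm (d i)).ae_eq_mk)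
  set N := toMeasurable P {ω | ¬ (Continuous (W · ω) ∧ ∀ i, W (d i) ω = (hm (d i)).mk _ ω)}
    with hN
  have mN : MeasurableSet N := measurableSet_toMeasurable _ _
  have hN0 : P N = 0 := by rw [hN, measure_toMeasurable]; exact hgood
  have hNc : ∀ ω, ω ∉ N → Continuous (W · ω) ∧ ∀ i, W (d i) ω = (hm (d i)).mk _ ω := by
    intro ω hω
    by_contra h
    exact hω (subset_toMeasurable _ _ h)
  refine ⟨fun t => Nᶜ.indicator (W t), fun t => ?_, fun ω => ?_, ?_⟩
  · obtain ⟨x, hx, hxt⟩ := mem_closure_iff_seq_limit.1 (TopologicalSpace.denseRange_denseSeq ℝ≥0 t)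
    refine measurable_of_tendsto_metrizable (f := fun n => Nᶜ.indicator (W (x n))) (fun n => ?_) ?_
    · obtain ⟨i, hi⟩ := hx n
      have : Nᶜ.indicator (W (x n)) = Nᶜ.indicator ((hm (d i)).mk _) := by
        funext ω
        by_cases hω : ω ∈ N
        · simp [hω]
        · rw [indicator_of_mem (show ω ∈ Nᶜ from hω), indicator_of_mem (show ω ∈ Nᶜ from hω), ← hi]
          exact (hNc ω hω).2 i
      rw [this]
      exact (hm (d i)).measurable_mk.indicator mN.compl
    · refine tendsto_pi_nhds.2 fun ω => ?_
      by_cases hω : ω ∈ N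
      · simp [hω]
      · have hω' : ω ∈ Nᶜ := hω
        simp only [indicator_of_mem hω']
        exact ((hNc ω hω).1.tendsto t).comp hxt
  · by_cases hω : ω ∈ N
    · simp [hω, continuous_const]
    · have hω' : ω ∈ Nᶜ := hω
      simp only [indicator_of_mem hω']
      exact (hNc ω hω).1
  · have : ∀ᵐ ω ∂P, ω ∉ N := measure_eq_zero_iff_ae_notMem.1 hN0
    filter_upwards [this] with ω hω t
    exact (indicator_of_mem (show ω ∈ Nᶜ from hω) _).symm

lemma firstPassageTime_congr {Ω : Type*} {W V : ℝ≥0 → Ω → ℝ} {ω : Ω} (h : ∀ t, W t ω = V t ω)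
    (b : ℝ → ℝ) : firstPassageTime W b ω = firstPassageTime V b ω := by
  simp only [firstPassageTime, h]

lemma isFiniteMeasure_firstPassageDistribution {Ω : Type*} [MeasurableSpace Ω]
    (W : ℝ≥0 → Ω → ℝ) (b : ℝ → ℝ) (P : Measure Ω) [IsFiniteMeasure P] :
    IsFiniteMeasure (firstPassageDistribution W b P) := by
  unfold firstPassageDistribution; infer_instance

lemma firstPassageDistribution_restrict_Ioo {Ω : Type*} [MeasurableSpace Ω] {P : Measure Ω}
    {W : ℝ≥0 → Ω → ℝ} {b : ℝ → ℝ} (mτ : Measurable (firstPassageTime W b))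
    (hreg : P {ω | firstPassageTime W b ω = 0} = 0) (t : ℝ≥0) :
    (firstPassageDistribution W b P).restrict (Ioo 0 (t : ℝ)) =
      (P.restrict {ω | firstPassageTime W b ω < t}).map
        fun ω => (firstPassageTime W b ω).toReal := by
  rw [firstPassageDistribution, Measure.restrict_map ENNReal.measurable_toReal measurableSet_Ioo,
    Measure.restrict_restrict (ENNReal.measurable_toReal measurableSet_Ioo),
    Measure.restrict_map mτ ((ENNReal.measurable_toReal measurableSet_Ioo).inter
      (measurableSet_singleton _).compl), Measure.map_map ENNReal.measurable_toReal mτ]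
  have : (firstPassageTime W b ⁻¹' (ENNReal.toReal ⁻¹' Ioo 0 (t : ℝ) ∩ {∞}ᶜ)) =ᵐ[P]
      {ω | firstPassageTime W b ω < t} := by
    have h0 : ∀ᵐ ω ∂P, firstPassageTime W b ω ≠ 0 := by
      simpa [ae_iff] using hreg
    filter_upwards [h0] with ω hω
    refine propext ?_
    change (_ ∧ _) ∧ _ ↔ firstPassageTime W b ω < t
    constructor
    · rintro ⟨⟨-, h1⟩, h2⟩
      have h2 : firstPassageTime W b ω ≠ ∞ := h2
      rwa [← ENNReal.toReal_lt_toReal h2 ENNReal.coe_ne_top, ENNReal.coe_toReal]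
    · intro h
      have h2 : firstPassageTime W b ω ≠ ∞ := (h.trans ENNReal.coe_lt_top).ne
      refine ⟨⟨ENNReal.toReal_pos hω h2, ?_⟩, h2⟩
      rwa [← ENNReal.toReal_lt_toReal h2 ENNReal.coe_ne_top, ENNReal.coe_toReal] at h
  rw [Measure.restrict_congr_set this]
  rfl

/-! ### The integral equation of negative order -/

/-- Up to the factor `√(2π)`, the kernel with `n = 0` is the expectation of `(y - N)₊^a` for a
Gaussian variable `N` with mean `m` and variance `r`. -/
lemma lintegral_gaussianReal_indicator_rpow {a : ℝ} (ha : -1 < a) {r : ℝ} (hr : 0 < r) (m y : ℝ) :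
    ∫⁻ n, (Iio y).indicator (fun x => ENNReal.ofReal ((y - x) ^ a)) (m + √r * n)
      ∂gaussianReal 0 1 = ENNReal.ofReal ((√(2 * Real.pi))⁻¹) *
        ENNReal.ofReal (hermiteKernel a 0 r (m - y)) := by
  have hsr := Real.sqrt_pos.2 hr
  have hra : √r ^ a = (r ^ (((0 : ℕ) - a) / 2))⁻¹ := by
    rw [Real.sqrt_eq_rpow, ← Real.rpow_mul hr.le, ← Real.rpow_neg hr.le]
    congr 1
    push_cast; ring
  set z := (m - y) / √r with hz
  have hzr : √r * z = m - y := by rw [hz]; field_simp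
  have mf : Measurable fun n : ℝ =>
      (Iio y).indicator (fun x => ENNReal.ofReal ((y - x) ^ a)) (m + √r * n) := by
    have : Measurable ((Iio y).indicator (fun x => ENNReal.ofReal ((y - x) ^ a))) := by
      refine Measurable.indicator ?_ measurableSet_Iio
      exact ((measurable_const.sub measurable_id).pow_const a).ennreal_ofReal
    exact this.comp (by fun_prop)
  have hint := integrableOn_hermiteGaussian_mul_rpow ha 0 z
  rw [gaussianReal_of_var_ne_zero _ one_ne_zero,
    lintegral_withDensity_eq_lintegral_mul _ (measurable_gaussianPDF 0 1) mf,
    -- the substitution `n = -z - u` turns `m + √r n < y` into `u > 0`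
    ← lintegral_sub_left_eq_self _ (-z), ← ENNReal.ofReal_mul (by positivity)]
  have hpt : ∀ u : ℝ, (gaussianPDF 0 1 * fun n : ℝ =>
      (Iio y).indicator (fun x => ENNReal.ofReal ((y - x) ^ a)) (m + √r * n)) (-z - u) =
      (Ioi (0 : ℝ)).indicator (fun u => ENNReal.ofReal
        ((√(2 * Real.pi))⁻¹ * √r ^ a * (hermiteGaussian 0 (u + z) * u ^ a))) u := by
    intro u
    have e : m + √r * (-z - u) = y - √r * u := by linear_combination -hzr
    rw [Pi.mul_apply, e]
    by_cases hu : 0 < u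
    · rw [indicator_of_mem (show u ∈ Ioi (0 : ℝ) from hu),
        indicator_of_mem (show y - √r * u ∈ Iio y by
          have := mul_pos hsr hu
          rw [mem_Iio]; linarith), gaussianPDF, ← ENNReal.ofReal_mul (gaussianPDFReal_nonneg _ _ _)]
      congr 1
      rw [sub_sub_cancel, Real.mul_rpow hsr.le hu.le, hermiteGaussian_zero, gaussianPDFReal]
      have e2 : -(-z - u - 0) ^ 2 / (2 * ((1 : ℝ≥0) : ℝ)) = -(u + z) ^ 2 / 2 := by
        push_cast; ring
      rw [e2]
      push_cast; ring_nf
    · rw [indicator_of_notMem (show u ∉ Ioi (0 : ℝ) from hu),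
        indicator_of_notMem (show y - √r * u ∉ Iio y by
          have := mul_nonneg hsr.le (neg_nonneg.2 (not_lt.1 hu))
          rw [mem_Iio]; linarith), mul_zero]
  rw [lintegral_congr hpt, lintegral_indicator measurableSet_Ioi,
    ← ofReal_integral_eq_lintegral_ofReal (hint.const_mul _), integral_const_mul]
  · congr 1
    rw [hermiteKernel, hra, hermiteIntegral]
    ring
  · filter_upwards [ae_restrict_mem measurableSet_Ioi] with u hu
    have hu : 0 < u := hu
    rw [hermiteGaussian_zero]
    simp only [Pi.zero_apply]
    positivity

lemma continuousOn_hermiteKernel_boundary {a : ℝ} (ha : -1 < a) (n : ℕ) {b : ℝ → ℝ}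
    (hb : ContinuousOn b (Ioi 0)) (t y : ℝ) :
    ContinuousOn (fun s => hermiteKernel a n (t - s) (b s - y)) (Ioo 0 t) := by
  have h : ContinuousOn (fun s => (t - s, b s - y)) (Ioo 0 t) :=
    (continuousOn_const.sub continuousOn_id).prodMk
      ((hb.mono Ioo_subset_Ioi_self).sub continuousOn_const)
  exact ContinuousOn.comp (g := fun q : ℝ × ℝ => hermiteKernel a n q.1 q.2)
    (f := fun s => (t - s, b s - y)) (continuousOn_hermiteKernel ha n) h
    (fun s hs => sub_pos.2 hs.2)

lemma aestronglyMeasurable_hermiteKernel_boundary {a : ℝ} (ha : -1 < a) (n : ℕ) {b : ℝ → ℝ}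
    (hb : ContinuousOn b (Ioi 0)) (t y : ℝ) (F : Measure ℝ) :
    AEStronglyMeasurable (fun s => hermiteKernel a n (t - s) (b s - y))
      (F.restrict (Ioo 0 t)) :=
  (continuousOn_hermiteKernel_boundary ha n hb t y).aestronglyMeasurable measurableSet_Ioo

lemma lintegral_hermiteKernel_firstPassageDistribution {Ω : Type*} [MeasurableSpace Ω]
    {P : Measure Ω} {W : ℝ≥0 → Ω → ℝ} (hW : IsPreBrownianReal W P) (hm : ∀ u, Measurable (W u))
    (hc : ∀ ω, Continuous (W · ω)) {b : ℝ → ℝ} (hb : ContinuousOn b (Ioi 0))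
    (hreg : P {ω | firstPassageTime W b ω = 0} = 0) {a : ℝ} (ha : -1 < a)
    {t : ℝ≥0} (ht : 0 < t) {y : ℝ} (hy : y < b t) :
    ∫⁻ s in Ioo 0 (t : ℝ), ENNReal.ofReal (hermiteKernel a 0 (t - s) (b s - y))
      ∂(firstPassageDistribution W b P) = ENNReal.ofReal (hermiteKernel a 0 t (0 - y)) := by
  have mτ := measurable_firstPassageTime hb hc hm
  have ht' : (0 : ℝ) < t := ht
  set f : ℝ → ℝ≥0∞ := (Iio y).indicator (fun x => ENNReal.ofReal ((y - x) ^ a)) with hf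
  have mf : Measurable f := Measurable.indicator
    ((measurable_const.sub measurable_id).pow_const a).ennreal_ofReal measurableSet_Iio
  set c := ENNReal.ofReal ((√(2 * Real.pi))⁻¹) with hcdef
  have hc0 : c ≠ 0 := (ENNReal.ofReal_pos.2 (by positivity)).ne'
  have mA : MeasurableSet {ω | firstPassageTime W b ω < t} := mτ measurableSet_Iio
  have hleft : ∫⁻ ω in {ω | firstPassageTime W b ω < t}, f (W t ω) ∂P =
      c * ENNReal.ofReal (hermiteKernel a 0 t (0 - y)) := by
    rw [← lintegral_indicator mA]
    -- a path ending below `y < b t` has crossed the boundary before time `t`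
    have e : ({ω | firstPassageTime W b ω < t}.indicator fun ω => f (W t ω)) =
        fun ω => f (W t ω) := by
      refine indicator_eq_self.2 fun ω hω => ?_
      have : W t ω ∈ Iio y := by
        by_contra h
        exact hω (indicator_of_notMem h _)
      exact firstPassageTime_lt_of_lt hb (hc ω) ht ((mem_Iio.1 this).trans hy)
    rw [e, ← lintegral_map mf (hm t), (hW.hasLaw_eval t).map_eq, ← gaussianReal_map_sqrt_mul,
      lintegral_map mf (by fun_prop), ← lintegral_gaussianReal_indicator_rpow ha ht' 0 y]
    simp only [zero_add, hf]
  have hright : ∫⁻ ω in {ω | firstPassageTime W b ω < t}, f (W t ω) ∂P =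
      c * ∫⁻ s in Ioo 0 (t : ℝ), ENNReal.ofReal (hermiteKernel a 0 (t - s) (b s - y))
        ∂(firstPassageDistribution W b P) := by
    have hmeas : AEMeasurable (fun s : ℝ => ENNReal.ofReal (hermiteKernel a 0 (t - s) (b s - y)))
        ((P.restrict {ω | firstPassageTime W b ω < t}).map
          fun ω => (firstPassageTime W b ω).toReal) := by
      rw [← firstPassageDistribution_restrict_Ioo mτ hreg]
      exact ((continuousOn_hermiteKernel_boundary ha 0 hb t y).aemeasurable
        measurableSet_Ioo).ennreal_ofReal
    rw [setLIntegral_firstPassageTime_lt hW hm hc hb ht mf,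
      firstPassageDistribution_restrict_Ioo mτ hreg,
      lintegral_map' hmeas mτ.ennreal_toReal.aemeasurable,
      ← lintegral_const_mul' _ _ ENNReal.ofReal_ne_top]
    refine lintegral_congr_ae ?_
    have h0 : ∀ᵐ ω ∂P, firstPassageTime W b ω ≠ 0 := by
      simpa [ae_iff] using hreg
    filter_upwards [ae_restrict_mem mA, ae_restrict_of_ae h0] with ω hω hω0
    have hω : firstPassageTime W b ω < t := hω
    have hfin : firstPassageTime W b ω ≠ ∞ := (hω.trans ENNReal.coe_lt_top).ne
    lift firstPassageTime W b ω to ℝ≥0 using hfin with u hu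
    have hu0 : 0 < u := pos_iff_ne_zero.2 fun h => hω0 (by rw [h]; rfl)
    have hut : (u : ℝ) < t := ENNReal.coe_lt_coe.1 hω
    rw [ENNReal.toNNReal_coe, ENNReal.coe_toReal, apply_firstPassageTime hb (hc ω) hu0 hu.symm]
    exact lintegral_gaussianReal_indicator_rpow ha (sub_pos.2 hut) (b u) y
  have := hleft.symm.trans hright
  exact ((ENNReal.mul_right_inj hc0 ENNReal.ofReal_ne_top).1 this).symm

/-! ### Raising the order -/

lemma hermiteKernel_zero_nonneg (a : ℝ) {r : ℝ} (hr : 0 ≤ r) (x : ℝ) :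
    0 ≤ hermiteKernel a 0 r x := by
  refine div_nonneg (setIntegral_nonneg measurableSet_Ioi fun u hu => ?_) (Real.rpow_nonneg hr _)
  have hu : 0 < u := hu
  rw [hermiteGaussian_zero]
  positivity

/-- If the integral equation holds for the kernel of index `0` and all `y < b t`, it can be
differentiated in `y` any number of times, since the kernels are bounded for `a ≤ 0`. -/
lemma integral_hermiteKernel_of_zero {a : ℝ} (ha : -1 < a) (ha0 : a ≤ 0) {b : ℝ → ℝ}
    (hb : ContinuousOn b (Ioi 0)) {t : ℝ} (ht : 0 < t) (F : Measure ℝ) [IsFiniteMeasure F]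
    (h0 : ∀ y < b t, hermiteKernel a 0 t (0 - y) =
      ∫ s in Ioo 0 t, hermiteKernel a 0 (t - s) (b s - y) ∂F) (n : ℕ) :
    ∀ y < b t, IntegrableOn (fun s => hermiteKernel a n (t - s) (b s - y)) (Ioo 0 t) F ∧
      hermiteKernel a n t (0 - y) =
        ∫ s in Ioo 0 t, hermiteKernel a n (t - s) (b s - y) ∂F := by
  have hint : ∀ n : ℕ, ∀ y < b t,
      IntegrableOn (fun s => hermiteKernel a n (t - s) (b s - y)) (Ioo 0 t) F := by
    intro n y hy
    obtain ⟨M, δ, hδ, hM⟩ := exists_abs_hermiteKernel_le ha ha0 n hb ht hy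
    refine Integrable.of_bound (aestronglyMeasurable_hermiteKernel_boundary ha n hb t y F) M ?_
    filter_upwards [ae_restrict_mem measurableSet_Ioo] with s hs
    exact hM s hs y (Metric.mem_ball_self hδ)
  induction n with
  | zero => exact fun y hy => ⟨hint 0 y hy, h0 y hy⟩
  | succ n ih =>
    intro y hy
    refine ⟨hint _ y hy, ?_⟩
    obtain ⟨M, δ, hδ, hM⟩ := exists_abs_hermiteKernel_le ha ha0 (n + 1) hb ht hy
    have hR := (hasDerivAt_integral_of_dominated_loc_of_deriv_le (μ := F.restrict (Ioo 0 t))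
      (F := fun y s => hermiteKernel a n (t - s) (b s - y))
      (F' := fun y s => hermiteKernel a (n + 1) (t - s) (b s - y)) (bound := fun _ => M)
      (Metric.ball_mem_nhds y hδ)
      (Eventually.of_forall fun y' => aestronglyMeasurable_hermiteKernel_boundary ha n hb t y' F)
      (hint n y hy) (aestronglyMeasurable_hermiteKernel_boundary ha (n + 1) hb t y F)
      (by filter_upwards [ae_restrict_mem measurableSet_Ioo] with s hs y' hy'
          exact hM s hs y' hy') (integrable_const _)
      (by filter_upwards [ae_restrict_mem measurableSet_Ioo] with s hs y' _
          exact hasDerivAt_hermiteKernel ha n (sub_pos.2 hs.2) (b s) y')).2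
    have hL := hasDerivAt_hermiteKernel ha n ht 0 y
    refine hL.unique (hR.congr_of_eventuallyEq ?_)
    filter_upwards [Iio_mem_nhds hy] with y' hy'
    exact (ih y' hy').2

/-! ### The integral equation for all orders -/

theorem theorem2 {Ω : Type*} [MeasurableSpace Ω] (P : Measure Ω) [IsProbabilityMeasure P]
    (W : ℝ≥0 → Ω → ℝ) (hW : IsBrownianReal W P)
    (b : ℝ → ℝ) (hb : ContinuousOn b (Ioi 0))
    (b₀ : EReal) (hb₀ : Tendsto (fun s : ℝ => (b s : EReal)) (𝓝[>] 0) (𝓝 b₀)) (hb₀_le : b₀ ≤ 0)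
    (hb₀_bot : b₀ = ⊥ → ∃ ε : ℝ, 0 < ε ∧ MonotoneOn b (Ioc 0 ε))
    (hreg : P {ω | firstPassageTime W b ω = 0} = 0)
    (p t y : ℝ) (ht : 0 < t) (hy : y < b t) :
    IntegrableOn
        (fun s : ℝ => Real.exp (-(b s - y) ^ 2 / (4 * (t - s))) *
          (parabolicCylinder p ((b s - y) / √(t - s)) / (t - s) ^ ((p + 1) / 2)))
        (Ioo 0 t) (firstPassageDistribution W b P) ∧
      Real.exp (-y ^ 2 / (4 * t)) * parabolicCylinder p (-y / √t) / t ^ ((p + 1) / 2) =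
        ∫ s in Ioo 0 t, Real.exp (-(b s - y) ^ 2 / (4 * (t - s))) *
          (parabolicCylinder p ((b s - y) / √(t - s)) / (t - s) ^ ((p + 1) / 2))
          ∂(firstPassageDistribution W b P) := by
  have hfin := isFiniteMeasure_firstPassageDistribution W b P
  set F := firstPassageDistribution W b P with hF
  have hzero : ∀ a : ℝ, -1 < a → ∀ y < b t,
      IntegrableOn (fun s => hermiteKernel a 0 (t - s) (b s - y)) (Ioo 0 t) F ∧
      hermiteKernel a 0 t (0 - y) =
        ∫ s in Ioo 0 t, hermiteKernel a 0 (t - s) (b s - y) ∂F := by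
    intro a ha y hy
    obtain ⟨V, mV, cV, hV⟩ := exists_measurable_continuous_modification
      (fun u => hW.toIsPreBrownianReal.aemeasurable u) hW.cont
    have hVτ : firstPassageTime W b =ᵐ[P] firstPassageTime V b := by
      filter_upwards [hV] with ω hω using firstPassageTime_congr hω b
    have hVpre : IsPreBrownianReal V P := hW.toIsPreBrownianReal.congr fun u => by
      filter_upwards [hV] with ω hω using hω u
    have hFV : F = firstPassageDistribution V b P := by
      rw [hF, firstPassageDistribution, firstPassageDistribution, Measure.map_congr hVτ]
    have hregV : P {ω | firstPassageTime V b ω = 0} = 0 := by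
      have h1 : ∀ᵐ ω ∂P, firstPassageTime W b ω ≠ 0 := by
        simpa [ae_iff] using hreg
      have h2 : ∀ᵐ ω ∂P, firstPassageTime V b ω ≠ 0 := by
        filter_upwards [h1, hVτ] with ω hω hω' using by rwa [← hω']
      simpa [ae_iff] using h2
    lift t to ℝ≥0 using ht.le
    have key := lintegral_hermiteKernel_firstPassageDistribution hVpre mV cV hb hregV ha
      (NNReal.coe_pos.1 ht) hy
    rw [← hFV] at key
    have hmeas := aestronglyMeasurable_hermiteKernel_boundary ha 0 hb t y F
    have hnn : 0 ≤ᵐ[F.restrict (Ioo 0 (t : ℝ))]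
        fun s => hermiteKernel a 0 (t - s) (b s - y) := by
      filter_upwards [ae_restrict_mem measurableSet_Ioo] with s hs
      exact hermiteKernel_zero_nonneg a (sub_nonneg.2 hs.2.le) _
    refine ⟨(lintegral_ofReal_ne_top_iff_integrable hmeas hnn).1
      (key.trans_ne ENNReal.ofReal_ne_top), ?_⟩
    rw [integral_eq_lintegral_of_nonneg_ae hnn hmeas, key,
      ENNReal.toReal_ofReal (hermiteKernel_zero_nonneg a ht.le _)]
  set a := cylinderExponent p with hadef
  set n := cylinderDerivCount p with hndef
  have ha : -1 < a := neg_one_lt_cylinderExponent p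
  have main : IntegrableOn (fun s => hermiteKernel a n (t - s) (b s - y)) (Ioo 0 t) F ∧
      hermiteKernel a n t (0 - y) =
        ∫ s in Ioo 0 t, hermiteKernel a n (t - s) (b s - y) ∂F := by
    by_cases hp : p < 0
    · rw [show n = 0 from if_pos hp]
      exact hzero a ha y hy
    · exact integral_hermiteKernel_of_zero ha (cylinderExponent_nonpos (not_lt.1 hp)) hb ht F
        (fun y hy => (hzero a ha y hy).2) n y hy
  have hcongr : EqOn (fun s : ℝ => Real.exp (-(b s - y) ^ 2 / (4 * (t - s))) *
      (parabolicCylinder p ((b s - y) / √(t - s)) / (t - s) ^ ((p + 1) / 2)))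
      (fun s => (Real.Gamma (n - p))⁻¹ * hermiteKernel a n (t - s) (b s - y)) (Ioo 0 t) := by
    intro s hs
    simp only
    rw [← mul_div_assoc, exp_mul_parabolicCylinder_div_rpow p (sub_pos.2 hs.2)]
  refine ⟨(integrableOn_congr_fun hcongr measurableSet_Ioo).2 (main.1.const_mul _), ?_⟩
  rw [setIntegral_congr_fun measurableSet_Ioo hcongr, integral_const_mul, ← main.2, zero_sub,
    ← exp_mul_parabolicCylinder_div_rpow p ht, neg_sq]
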